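/- Let $a<b$ be real numbers, $\sigma>0$ and $\alpha\in(\tfrac12,1)$. For $\varphi\in C_0^\infty(a,b)$ let $${}^C\mathbb{D}^{\alpha,\sigma}_{a^+}\varphi(x)=\frac{e^{-\sigma x}}{\Gamma(1-\alpha)}\int_a^x (x-s)^{-\alpha}\,\big(e^{\sigma s}\varphi(s)\big)'\,ds$$ be the left tempered Caputo derivative. Let $\mathbb{H}_0^{\alpha,\sigma}(a,b)\subset L^2(a,b)$ be the completion of $C_0^\infty(a,b)$ for the norm $\big(\|\varphi\|_{L^2}^2+\|{}^C\mathbb{D}^{\alpha,\sigma}_{a^+}\varphi\|_{L^2}^2\big)^{1/2}$; that is, $u\in L^2(a,b)$ belongs to $\mathbb{H}_0^{\alpha,\sigma}(a,b)$ if and only if there are $\varphi_n\in C_0^\infty(a,b)$ with $\varphi_n\to u$ and ${}^C\mathbb{D}^{\alpha,\sigma}_{a^+}\varphi_n\to v$ in $L^2(a,b)$ for some $v\in L^2(a,b)$. This $v$ is unique and is denoted ${}^C\mathbb{D}^{\alpha,\sigma}_{a^+}u$. Let $L:\mathbb{R}\times\mathbb{R}\times[a,b]\to\mathbb{R}$,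 $(x,y,t)\mapsto L(x,y,t)$, be of class $C^1$ and suppose the following. - $(L_1)$ There are $d_1\in(0,2]$ and continuous $r_1,s_1:\mathbb{R}\times[a,b]\to[0,\infty)$ with $|L(x,y,t)-L(x,0,t)|\le r_1(x,t)|y|^{d_1}+s_1(x,t)$ for all $(x,y,t)\in\mathbb{R}\times\mathbb{R}\times[a,b]$. - $(L_2)$ There are $d_2\in(0,2]$ and continuous $r_2,s_2:\mathbb{R}\times[a,b]\to[0,\infty)$ with $\left|\frac{\partial L}{\partial x}(x,y,t)\right|\le r_2(x,t)|y|^{d_2}+s_2(x,t)$ for all $(x,y,t)$. - $(L_3)$ There are $d_3\in(0,1]$ and continuous $r_3,s_3:\mathbb{R}\times[a,b]\to[0,\infty)$ with $\left|\frac{\partial L}{\partial y}(x,y,t)\right|\le r_3(x,t)|y|^{d_3}+s_3(x,t)$ for all $(x,y,t)$. - $(L_4)$ There are $\zeta>0$, $d_4\in[1,2)$, a continuous $c_1:\mathbb{R}\times[a,b]\to[\zeta,\infty)$ and continuous $c_2,c_3:[a,b]\to\mathbb{R}$ with $L(x,y,t)\ge c_1(x,t)|y|^2+c_2(t)|x|^{d_4}+c_3(t)$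 for all $(x,y,t)$. - $(L_5)$ For every $t\in[a,b]$ the function $(x,y)\mapsto L(x,y,t)$ is convex on $\mathbb{R}^2$. Then for every $u\in\mathbb{H}_0^{\alpha,\sigma}(a,b)$ the function $t\mapsto L\big(u(t),{}^C\mathbb{D}^{\alpha,\sigma}_{a^+}u(t),t\big)$ is integrable on $(a,b)$, and the functional $$\mathcal{J}(u)=\int_a^b L\big(u(t),{}^C\mathbb{D}^{\alpha,\sigma}_{a^+}u(t),t\big)\,dt$$ has a global minimizer on $\mathbb{H}_0^{\alpha,\sigma}(a,b)$: there is $u_0\in\mathbb{H}_0^{\alpha,\sigma}(a,b)$ with $\mathcal{J}(u_0)\le\mathcal{J}(u)$ for all $u\in\mathbb{H}_0^{\alpha,\sigma}(a,b)$. If moreover $(x,y)\mapsto L(x,y,t)$ is strictly convex for every $t\in[a,b]$, the global minimizer is unique. -/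

import Mathlib

open MeasureTheory Set

namespace TemperedFractional

noncomputable section

/-- The real Hilbert space `L²(a,b)` (Lebesgue measure, functions up to a.e. equality). -/
abbrev L2 (a b : ℝ) : Type := Lp ℝ 2 (volume.restrict (Ioo a b))

/-- The left tempered Caputo derivative of order `α` and parameter `σ`, by its classical formula
`e^{-σx} / Γ(1-α) * ∫_a^x (x-s)^{-α} (e^{σs} u(s))' ds`. -/
def caputo (a α σ : ℝ) (u : ℝ → ℝ) (x : ℝ) : ℝ :=
  Real.exp (-σ * x) / Real.Gamma (1 - α) *
    ∫ s in a..x, (x - s) ^ (-α) * deriv (fun r => Real.exp (σ * r) * u r) s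

/-- `φ ∈ C₀^∞(a,b)`: smooth, with compact support contained in `(a,b)`. -/
structure IsTest (a b : ℝ) (φ : ℝ → ℝ) : Prop where
  smooth : ContDiff ℝ (⊤ : ℕ∞) φ
  compact : HasCompactSupport φ
  subset : tsupport φ ⊆ Ioo a b

/-- The pairs (class of `φ`, class of the classical derivative of `φ`) in `L²(a,b) × L²(a,b)`,
for `φ ∈ C₀^∞(a,b)`. -/
def testGraph (a b α σ : ℝ) : Set (L2 a b × L2 a b) :=
  {p | ∃ φ : ℝ → ℝ, IsTest a b φ ∧
    (p.1 =ᵐ[volume.restrict (Ioo a b)] φ) ∧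
    (p.2 =ᵐ[volume.restrict (Ioo a b)] caputo a α σ φ)}

/-- `v` is the tempered Caputo derivative of `u` in the completion of `C₀^∞(a,b)` for the norm
`(‖u‖² + ‖v‖²)^{1/2}`: there are test functions `φₙ → u` in `L²(a,b)` whose classical derivatives
converge to `v` in `L²(a,b)`. (The product carries the equivalent maximum norm.) -/
def HasCaputo (a b α σ : ℝ) (u v : L2 a b) : Prop :=
  (u, v) ∈ closure (testGraph a b α σ)

/-- The space `ℍ₀^{α,σ}(a,b)`: the completion of `C₀^∞(a,b)` for the norm
`(‖φ‖²_{L²} + ‖caputo φ‖²_{L²})^{1/2}`, realised inside `L²(a,b)`. -/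
def H0 (a b α σ : ℝ) : Set (L2 a b) :=
  {u | ∃ v, HasCaputo a b α σ u v}

open Classical in
/-- The tempered Caputo derivative on `ℍ₀^{α,σ}(a,b)`, the unique continuous extension of the
classical one from `C₀^∞(a,b)`; see `HasCaputo.unique`. (The value `0` outside the space is
irrelevant.) -/
def caputoH0 (a b α σ : ℝ) (u : L2 a b) : L2 a b :=
  if h : ∃ v, HasCaputo a b α σ u v then h.choose else 0

/-- The integrand `t ↦ L(u(t), D u(t), t)`. -/
def lagrangian (a b α σ : ℝ) (L : ℝ → ℝ → ℝ → ℝ) (u : L2 a b) (t : ℝ) : ℝ :=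
  L (u t) (caputoH0 a b α σ u t) t

/-- The functional `J(u) = ∫_a^b L(u(t), D u(t), t) dt`. -/
def functional (a b α σ : ℝ) (L : ℝ → ℝ → ℝ → ℝ) (u : L2 a b) : ℝ :=
  ∫ t in Ioo a b, lagrangian a b α σ L u t

/-! The derivative on `ℍ₀^{α,σ}(a,b)` is well defined and extends the classical one. -/

/-- The kernel `r^{-α}` on `(0, b - a)`, extended by zero. -/
def kernel (a b α : ℝ) : ℝ → ℝ := (Ioo 0 (b - a)).indicator fun r => r ^ (-α)

theorem kernel_integrable {a b α : ℝ} (hab : a < b) (hα : α < 1) :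
    Integrable (kernel a b α) := by
  have h : IntervalIntegrable (fun r : ℝ => r ^ (-α)) volume 0 (b - a) :=
    intervalIntegral.intervalIntegrable_rpow' (by linarith)
  rw [intervalIntegrable_iff_integrableOn_Ioo_of_le (by linarith)] at h
  exact h.integrable_indicator measurableSet_Ioo

/-- `φ` multiplied by the exponential weight. -/
def weighted (σ : ℝ) (φ : ℝ → ℝ) (r : ℝ) : ℝ := Real.exp (σ * r) * φ r

theorem IsTest.weighted {a b σ : ℝ} {φ : ℝ → ℝ} (h : IsTest a b φ) :
    IsTest a b (weighted σ φ) where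
  smooth := by
    have := h.smooth
    unfold TemperedFractional.weighted
    fun_prop
  compact := HasCompactSupport.mul_left h.compact
  subset := (closure_mono (Function.support_mul_subset_right _ _)).trans h.subset

theorem caputo_eq {a b α σ : ℝ} {φ : ℝ → ℝ} (h : IsTest a b φ) {x : ℝ} (hx : x ∈ Ioo a b) :
    caputo a α σ φ x = Real.exp (-σ * x) / Real.Gamma (1 - α) *
      convolution (deriv (weighted σ φ)) (kernel a b α) (ContinuousLinearMap.mul ℝ ℝ) volume x := by
  unfold caputo
  congr 1
  rw [intervalIntegral.integral_of_le hx.1.le, integral_Ioc_eq_integral_Ioo, convolution_def,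
    ← integral_indicator measurableSet_Ioo]
  refine integral_congr_ae (Filter.Eventually.of_forall fun s => ?_)
  simp only [ContinuousLinearMap.mul_apply', kernel]
  have hw : s ∉ Ioo a b → deriv (weighted σ φ) s = 0 := fun hs =>
    image_eq_zero_of_notMem_tsupport fun h1 =>
      hs (h.weighted.subset (tsupport_deriv_subset h1))
  by_cases hs : s ∈ Ioo a x
  · have h1 : x - s ∈ Ioo 0 (b - a) := ⟨by linarith [hs.2], by linarith [hs.1, hx.2]⟩
    rw [indicator_of_mem hs, indicator_of_mem h1, mul_comm]
    rfl
  · rw [indicator_of_notMem hs]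
    by_cases hs' : s ∈ Ioo a b
    · have h1 : x - s ∉ Ioo 0 (b - a) := fun h1 => hs ⟨hs'.1, by linarith [h1.1]⟩
      rw [indicator_of_notMem h1, mul_zero]
    · rw [hw hs', zero_mul]

theorem caputo_memLp {a b α σ : ℝ} (hab : a < b) (hα : α < 1) {φ : ℝ → ℝ} (h : IsTest a b φ) :
    MemLp (caputo a α σ φ) 2 (volume.restrict (Ioo a b)) := by
  have hc : Continuous (convolution (deriv (weighted σ φ)) (kernel a b α)
      (ContinuousLinearMap.mul ℝ ℝ) volume) :=
    HasCompactSupport.continuous_convolution_left _ h.weighted.compact.deriv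
      (h.weighted.smooth.continuous_deriv (by simp))
      (kernel_integrable hab hα).locallyIntegrable
  have hc' : Continuous fun x => Real.exp (-σ * x) / Real.Gamma (1 - α) *
      convolution (deriv (weighted σ φ)) (kernel a b α) (ContinuousLinearMap.mul ℝ ℝ) volume x := by
    fun_prop
  obtain ⟨C, hC⟩ := isCompact_Icc.exists_bound_of_continuousOn (hc'.continuousOn (s := Icc a b))
  have h2 : MemLp (fun x => Real.exp (-σ * x) / Real.Gamma (1 - α) *
      convolution (deriv (weighted σ φ)) (kernel a b α) (ContinuousLinearMap.mul ℝ ℝ) volume x) 2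
      (volume.restrict (Ioo a b)) :=
    MemLp.of_bound hc'.aestronglyMeasurable C ((ae_restrict_iff' measurableSet_Ioo).2
      (Filter.Eventually.of_forall fun x hx => hC x (Ioo_subset_Icc_self hx)))
  refine (memLp_congr_ae ?_).2 h2
  exact (ae_restrict_iff' measurableSet_Ioo).2
    (Filter.Eventually.of_forall fun x hx => caputo_eq h hx)

/-- The transposed operator on a smooth function `h`: `s ↦ -e^{σs} ∫ k(x-s) h'(x) dx`. -/
def transpose (a b α σ : ℝ) (h : ℝ → ℝ) (s : ℝ) : ℝ :=
  -Real.exp (σ * s) * ∫ x, kernel a b α (x - s) * deriv h x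

theorem integral_caputo_mul {a b α σ : ℝ} (hab : a < b) (hα : α < 1) {φ h : ℝ → ℝ}
    (hφ : IsTest a b φ) (hh : IsTest a b h) :
    ∫ x in Ioo a b, caputo a α σ φ x * (Real.Gamma (1 - α) * Real.exp (σ * x) * h x) =
      ∫ s in Ioo a b, φ s * transpose a b α σ h s := by
  have hk := kernel_integrable hab hα
  have hG : Real.Gamma (1 - α) ≠ 0 := (Real.Gamma_pos_of_pos (by linarith)).ne'
  set w := weighted σ φ with hw
  have hwt : IsTest a b w := hφ.weighted
  have hwc : Continuous w := hwt.smooth.continuous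
  have hwi : Integrable w := hwc.integrable_of_hasCompactSupport hwt.compact
  have hhc : Continuous (deriv h) := hh.smooth.continuous_deriv (by simp)
  set K := convolution w (kernel a b α) (ContinuousLinearMap.mul ℝ ℝ) volume with hK
  set K' := convolution (deriv w) (kernel a b α) (ContinuousLinearMap.mul ℝ ℝ) volume with hK'
  have hd : ∀ x, HasDerivAt K (K' x) x := fun x =>
    HasCompactSupport.hasDerivAt_convolution_left _ hwt.compact (hwt.smooth.of_le (by simp))
      hk.locallyIntegrable x
  have hKc : Continuous K := continuous_iff_continuousAt.2 fun x => (hd x).continuousAt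
  have hK'c : Continuous K' :=
    HasCompactSupport.continuous_convolution_left _ hwt.compact.deriv
      (hwt.smooth.continuous_deriv (by simp)) hk.locallyIntegrable
  have hz : ∀ x, x ∉ Ioo a b → h x = 0 := fun x hx =>
    image_eq_zero_of_notMem_tsupport fun h1 => hx (hh.subset h1)
  have hφz : ∀ x, x ∉ Ioo a b → φ x = 0 := fun x hx =>
    image_eq_zero_of_notMem_tsupport fun h1 => hx (hφ.subset h1)
  have e1 : ∫ x in Ioo a b, caputo a α σ φ x * (Real.Gamma (1 - α) * Real.exp (σ * x) * h x) =
      ∫ x, K' x * h x := by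
    rw [← integral_indicator measurableSet_Ioo]
    refine integral_congr_ae (Filter.Eventually.of_forall fun x => ?_)
    by_cases hx : x ∈ Ioo a b
    · simp only [indicator_of_mem hx]
      rw [caputo_eq hφ hx, neg_mul, Real.exp_neg]
      have := (Real.exp_pos (σ * x)).ne'
      field_simp
      exact mul_comm _ _
    · simp only [indicator_of_notMem hx, hz x hx, mul_zero]
  have e2 : ∫ x, K' x * h x = -∫ x, K x * deriv h x := by
    have hdh : ∀ x, HasDerivAt h (deriv h x) x := fun x =>
      ((hh.smooth.differentiable (by simp)) x).hasDerivAt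
    have := integral_mul_deriv_eq_deriv_mul_of_integrable (u := K) (v := h) (u' := K')
      (v' := deriv h) (fun x _ => hd x) (fun x _ => hdh x)
      ((hKc.mul hhc).integrable_of_hasCompactSupport hh.compact.deriv.mul_left)
      ((hK'c.mul hh.smooth.continuous).integrable_of_hasCompactSupport hh.compact.mul_left)
      ((hKc.mul hh.smooth.continuous).integrable_of_hasCompactSupport hh.compact.mul_left)
    rw [this, neg_neg]
  have e3 : ∫ x, K x * deriv h x = ∫ s, w s * ∫ x, kernel a b α (x - s) * deriv h x := by
    obtain ⟨C, hC⟩ := hh.compact.deriv.exists_bound_of_continuous hhc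
    have hi : Integrable (fun p : ℝ × ℝ => w p.2 * kernel a b α (p.1 - p.2) * deriv h p.1)
        (volume.prod volume) := by
      have := hwi.convolution_integrand (ContinuousLinearMap.mul ℝ ℝ) hk
      exact this.mul_bdd (c := C) (hhc.comp continuous_fst).aestronglyMeasurable
        (Filter.Eventually.of_forall fun p => hC p.1)
    calc ∫ x, K x * deriv h x
        = ∫ x, ∫ s, w s * kernel a b α (x - s) * deriv h x := by
          refine integral_congr_ae (Filter.Eventually.of_forall fun x => ?_)
          simp only [hK, convolution_def, ContinuousLinearMap.mul_apply']
          rw [integral_mul_const]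
      _ = ∫ s, ∫ x, w s * kernel a b α (x - s) * deriv h x := integral_integral_swap hi
      _ = _ := by
          refine integral_congr_ae (Filter.Eventually.of_forall fun s => ?_)
          simp only [mul_assoc]
          rw [integral_const_mul]
  rw [e1, e2, e3, ← integral_indicator measurableSet_Ioo, ← integral_neg]
  refine integral_congr_ae (Filter.Eventually.of_forall fun s => ?_)
  by_cases hs : s ∈ Ioo a b
  · simp only [indicator_of_mem hs, transpose, hw, weighted]
    ring
  · simp only [indicator_of_notMem hs, hw, weighted, hφz s hs]
    ring

theorem transpose_memLp {a b α σ : ℝ} (hab : a < b) (hα : α < 1) {h : ℝ → ℝ}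
    (hh : IsTest a b h) : MemLp (transpose a b α σ h) 2 (volume.restrict (Ioo a b)) := by
  have hk := kernel_integrable hab hα
  have hhc : Continuous (deriv h) := hh.smooth.continuous_deriv (by simp)
  obtain ⟨C, hC⟩ := hh.compact.deriv.exists_bound_of_continuous hhc
  have hc : Continuous (transpose a b α σ h) := by
    have : ∀ s, ∫ x, kernel a b α (x - s) * deriv h x =
        ∫ r, kernel a b α r * deriv h (r + s) := fun s => by
      rw [← integral_sub_right_eq_self (fun r => kernel a b α r * deriv h (r + s)) s]
      simp
    unfold transpose
    simp only [this]
    refine Continuous.mul (by fun_prop) ?_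
    refine continuous_of_dominated (bound := fun r => ‖kernel a b α r‖ * C) ?_ ?_ ?_ ?_
    · intro s
      exact hk.aestronglyMeasurable.mul (by fun_prop)
    · intro s
      refine Filter.Eventually.of_forall fun r => ?_
      rw [norm_mul]
      exact mul_le_mul_of_nonneg_left (hC _) (norm_nonneg _)
    · exact hk.norm.mul_const C
    · exact Filter.Eventually.of_forall fun r => by fun_prop
  obtain ⟨D, hD⟩ := isCompact_Icc.exists_bound_of_continuousOn (hc.continuousOn (s := Icc a b))
  exact MemLp.of_bound hc.aestronglyMeasurable D ((ae_restrict_iff' measurableSet_Ioo).2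
      (Filter.Eventually.of_forall fun x hx => hD x (Ioo_subset_Icc_self hx)))

/-- The derivative of an element of the completion is unique. -/
theorem HasCaputo.unique {a b α σ : ℝ} (hab : a < b) (hα : α < 1) {u v v' : L2 a b}
    (hv : HasCaputo a b α σ u v) (hv' : HasCaputo a b α σ u v') : v = v' := by
  have hG : Real.Gamma (1 - α) ≠ 0 := (Real.Gamma_pos_of_pos (by linarith)).ne'
  have key : ∀ h : ℝ → ℝ, IsTest a b h → ∃ A B : L2 a b,
      (A =ᵐ[volume.restrict (Ioo a b)] fun x => Real.Gamma (1 - α) * Real.exp (σ * x) * h x) ∧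
      ∀ p ∈ closure (testGraph a b α σ), inner ℝ p.2 A = inner ℝ p.1 B := by
    intro h hh
    have hm : MemLp (fun x => Real.Gamma (1 - α) * Real.exp (σ * x) * h x) 2
        (volume.restrict (Ioo a b)) := by
      have := hh.smooth.continuous
      exact Continuous.memLp_of_hasCompactSupport (by fun_prop) hh.compact.mul_left
    have hB := transpose_memLp (σ := σ) hab hα hh
    refine ⟨hm.toLp _, hB.toLp _, hm.coeFn_toLp, fun p hp => ?_⟩
    refine closure_minimal (s := testGraph a b α σ)
      (t := {p | inner ℝ p.2 (hm.toLp _) = inner ℝ p.1 (hB.toLp _)}) ?_ ?_ hp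
    · rintro p ⟨φ, hφ, h1, h2⟩
      simp only [mem_ofPred_eq, L2.inner_def, RCLike.inner_apply, conj_trivial]
      calc _ = ∫ x in Ioo a b,
              caputo a α σ φ x * (Real.Gamma (1 - α) * Real.exp (σ * x) * h x) := by
            refine integral_congr_ae ?_
            filter_upwards [h2, hm.coeFn_toLp] with x hx1 hx2
            rw [hx1, hx2, mul_comm]
        _ = ∫ s in Ioo a b, φ s * transpose a b α σ h s := integral_caputo_mul hab hα hφ hh
        _ = _ := by
            refine integral_congr_ae ?_
            filter_upwards [h1, hB.coeFn_toLp] with x hx1 hx2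
            rw [hx1, hx2, mul_comm]
    · exact isClosed_eq (by fun_prop) (by fun_prop)
  have hsub : ∀ᵐ x, x ∈ Ioo a b → (v - v' : L2 a b) x = 0 := by
    have hloc : Integrable (v - v' : L2 a b) (volume.restrict (Ioo a b)) :=
      (Lp.memLp (v - v')).integrable (by norm_num)
    refine isOpen_Ioo.ae_eq_zero_of_integral_contDiff_smul_eq_zero
      (IntegrableOn.locallyIntegrableOn hloc) fun g hg1 hg2 hg3 => ?_
    have hgt : IsTest a b g := ⟨hg1, hg2, hg3⟩
    obtain ⟨A, B, hA, hAB⟩ := key (fun x => Real.exp (-σ * x) * g x) hgt.weighted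
    have h0 : inner ℝ (v - v') A = 0 := by
      rw [inner_sub_left, hAB _ hv, hAB _ hv', sub_self]
    rw [L2.inner_def] at h0
    simp only [RCLike.inner_apply, conj_trivial] at h0
    have h1 : ∫ x in Ioo a b, A x * (v - v' : L2 a b) x =
        Real.Gamma (1 - α) * ∫ x, g x • (v - v' : L2 a b) x := by
      have h2 : ∫ x in Ioo a b, g x • (v - v' : L2 a b) x =
          ∫ x, g x • (v - v' : L2 a b) x := by
        refine setIntegral_eq_integral_of_forall_compl_eq_zero fun x hx => ?_
        rw [image_eq_zero_of_notMem_tsupport fun h1 => hx (hg3 h1), zero_smul]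
      rw [← h2, ← integral_const_mul]
      refine integral_congr_ae ?_
      filter_upwards [hA] with x hx
      rw [hx, neg_mul, Real.exp_neg, smul_eq_mul]
      have := (Real.exp_pos (σ * x)).ne'
      field_simp
    rw [h1] at h0
    exact (mul_eq_zero.1 h0).resolve_left hG
  refine sub_eq_zero.1 ((Lp.eq_zero_iff_ae_eq_zero).2 ?_)
  exact (ae_restrict_iff' measurableSet_Ioo).2 hsub

theorem HasCaputo.caputoH0_eq {a b α σ : ℝ} (hab : a < b) (hα : α < 1) {u v : L2 a b}
    (hv : HasCaputo a b α σ u v) : caputoH0 a b α σ u = v := by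
  have h : ∃ v, HasCaputo a b α σ u v := ⟨v, hv⟩
  rw [caputoH0, dif_pos h]
  exact h.choose_spec.unique hab hα hv

/-- Test functions belong to the space, and there the derivative is the classical one. -/
theorem IsTest.mem_H0 {a b α σ : ℝ} (hab : a < b) (hα : α < 1) {φ : ℝ → ℝ} (hφ : IsTest a b φ) :
    ∃ u ∈ H0 a b α σ, (u =ᵐ[volume.restrict (Ioo a b)] φ) ∧
      (caputoH0 a b α σ u =ᵐ[volume.restrict (Ioo a b)] caputo a α σ φ) := by
  have h1 : MemLp φ 2 (volume.restrict (Ioo a b)) :=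
    hφ.smooth.continuous.memLp_of_hasCompactSupport hφ.compact
  have h2 := caputo_memLp (σ := σ) hab hα hφ
  have h3 : HasCaputo a b α σ (h1.toLp φ) (h2.toLp _) :=
    subset_closure ⟨φ, hφ, h1.coeFn_toLp, h2.coeFn_toLp⟩
  refine ⟨h1.toLp φ, ⟨_, h3⟩, h1.coeFn_toLp, ?_⟩
  rw [h3.caputoH0_eq hab hα]
  exact h2.coeFn_toLp

end

end TemperedFractional

/-! The space is handled through the closed graph `G = closure (testGraph a b α σ)` in `L² × L²`. It
is convex, and by uniqueness of the derivative it is the graph of `caputoH0` over `H0`, so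
minimizing `J` over `H0` means minimizing an integral functional over `G`.

The analytic core is a sup-norm Poincaré inequality (`exists_ae_abs_le_mul_norm`): `|u| ≤ P ‖Du‖`
a.e. By Abel's identity, convolution with `r^(α-1)` inverts the fractional derivative up to a
constant and exponential weights; for `α > 1/2` this kernel is square integrable, and Cauchy–Schwarz
applies. Two things follow. Each `u` is bounded, so the growth condition bounds `L(u, Du, t)` by `C
(1 + |Du|²)` and `J` is finite. And since `d₄ < 2`, the term `c₂ |u|^d₄` costs at most `ε u² + K`,
which half of `ζ ‖Du‖²` absorbs, so `J` controls the graph norm.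

Existence is the direct method without weak topologies. Sublevel sets of `J` on `G` are convex,
bounded, and norm closed by Fatou (`integralFunctional_le_of_tendsto`); nested nonempty sets of this
kind in a Hilbert space intersect (`nonempty_iInter_of_antitone`). Uniqueness compares two
minimizers with their midpoint. -/

namespace TemperedFractional

open Filter Topology

/-! ### Abel inversion and the sup-norm Poincaré inequality -/

/-- The value `∫₀¹ (1-τ)^{α-1} τ^{-α} dτ`. -/
noncomputable def betaConst (α : ℝ) : ℝ := ∫ τ in (0 : ℝ)..1, (1 - τ) ^ (α - 1) * τ ^ (-α)

/-- Integrability is read off from the convergent complex beta integral `B(1-α, α)` by taking norms.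
Positivity permits division by this constant when the derivative is inverted. -/
theorem betaConst_pos {α : ℝ} (h0 : 0 < α) (h1 : α < 1) : 0 < betaConst α := by
  refine intervalIntegral.intervalIntegral_pos_of_pos_on ?_ ?_ one_pos
  · have h := (Complex.betaIntegral_convergent (u := ((1 - α : ℝ) : ℂ)) (v := (α : ℂ))
      (by simpa using h1) (by simpa using h0)).norm
    rw [intervalIntegrable_iff_integrableOn_Ioo_of_le zero_le_one] at h ⊢
    refine h.congr_fun (fun x hx => ?_) measurableSet_Ioo
    have e : (1 - (x : ℂ)) = ((1 - x : ℝ) : ℂ) := by push_cast; ring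
    simp only [norm_mul]
    rw [e, Complex.norm_cpow_eq_rpow_re_of_pos hx.1,
      Complex.norm_cpow_eq_rpow_re_of_pos (by linarith [hx.2]), mul_comm]
    simp
  · intro x hx
    exact mul_pos (Real.rpow_pos_of_pos (by linarith [hx.2]) _) (Real.rpow_pos_of_pos hx.1 _)

/-- The substitution `s = (x-r)τ + r` produces powers of `x-r` with exponents `α-1` and `-α`;
together with the Jacobian they cancel. Hence the composed kernel is a constant times a Heaviside
function, that is, the kernel of ordinary integration. -/
theorem integral_kernel_kernel {a b α r x : ℝ} (hr : r ∈ Ioo a b) (hx : x ∈ Ioo a b) :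
    ∫ s, kernel a b (1 - α) (x - s) * kernel a b α (s - r) =
      if r < x then betaConst α else 0 := by
  split_ifs with h
  · have e : (fun s => kernel a b (1 - α) (x - s) * kernel a b α (s - r)) =
        (Ioo r x).indicator fun s => (x - s) ^ (α - 1) * (s - r) ^ (-α) := by
      funext s
      by_cases hs : s ∈ Ioo r x
      · rw [indicator_of_mem hs, kernel, kernel, indicator_of_mem, indicator_of_mem]
        · simp
        · exact ⟨by linarith [hs.1], by linarith [hs.2, hx.2, hr.1]⟩
        · exact ⟨by linarith [hs.2], by linarith [hs.1, hx.2, hr.1]⟩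
      · rw [indicator_of_notMem hs, kernel, kernel]
        by_cases h1 : s < x
        · have h2 : s - r ∉ Ioo 0 (b - a) := fun h2 => hs ⟨by linarith [h2.1], h1⟩
          rw [indicator_of_notMem h2, mul_zero]
        · have h2 : x - s ∉ Ioo 0 (b - a) := fun h2 => h1 (by linarith [h2.1])
          rw [indicator_of_notMem h2, zero_mul]
    rw [e, integral_indicator measurableSet_Ioo, ← integral_Ioc_eq_integral_Ioo,
      ← intervalIntegral.integral_of_le h.le, betaConst]
    have hxr : 0 < x - r := sub_pos.2 h
    have := intervalIntegral.smul_integral_comp_mul_add (a := 0) (b := 1)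
      (fun s => (x - s) ^ (α - 1) * (s - r) ^ (-α)) (x - r) r
    simp only [mul_zero, zero_add, mul_one, sub_add_cancel] at this
    rw [← this, smul_eq_mul, ← intervalIntegral.integral_const_mul]
    refine intervalIntegral.integral_congr fun τ hτ => ?_
    rw [uIcc_of_le zero_le_one] at hτ
    have e1 : x - ((x - r) * τ + r) = (x - r) * (1 - τ) := by ring
    have e2 : (x - r) * τ + r - r = (x - r) * τ := by ring
    simp only [e1, e2]
    rw [Real.mul_rpow hxr.le (by linarith [hτ.2]), Real.mul_rpow hxr.le hτ.1]
    have e3 : (x - r) * ((x - r) ^ (α - 1) * (x - r) ^ (-α)) = 1 := by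
      rw [← Real.rpow_add hxr, show α - 1 + -α = -1 by ring, Real.rpow_neg_one,
        mul_inv_cancel₀ hxr.ne']
    linear_combination ((1 - τ) ^ (α - 1) * τ ^ (-α)) * e3
  · rw [← integral_zero ℝ ℝ]
    congr 1
    funext s
    rw [kernel, kernel]
    by_cases h1 : s < x
    · have h2 : s - r ∉ Ioo 0 (b - a) := fun h2 => h (by linarith [h2.1])
      rw [indicator_of_notMem h2, mul_zero]
    · have h2 : x - s ∉ Ioo 0 (b - a) := fun h2 => h1 (by linarith [h2.1])
      rw [indicator_of_notMem h2, zero_mul]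

/-- Fractional integration of order `α` inverts the fractional derivative of order `α`, up to the
normalising constant. -/
theorem integral_kernel_convolution {a b α : ℝ} (hab : a < b) (h0 : 0 < α) (h1 : α < 1)
    {w : ℝ → ℝ} (hw : IsTest a b w) {x : ℝ} (hx : x ∈ Ioo a b) :
    ∫ s, kernel a b (1 - α) (x - s) *
      convolution (deriv w) (kernel a b α) (ContinuousLinearMap.mul ℝ ℝ) volume s =
        betaConst α * w x := by
  have hk1 := kernel_integrable hab h1
  have hk2 := kernel_integrable (α := 1 - α) hab (by linarith)
  have hwc : Continuous (deriv w) := hw.smooth.continuous_deriv (by simp)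
  have hwz : ∀ r, r ∉ Ioo a b → deriv w r = 0 := fun r hr =>
    image_eq_zero_of_notMem_tsupport fun h2 => hr (hw.subset (tsupport_deriv_subset h2))
  obtain ⟨C, hC⟩ := hw.compact.deriv.exists_bound_of_continuous hwc
  have hi : Integrable (fun p : ℝ × ℝ =>
      kernel a b (1 - α) (x - p.2) * kernel a b α (p.2 - p.1) * deriv w p.1)
      (volume.prod volume) := by
    -- The integrand is that of the convolution of two integrable functions, the second being the
    -- reflected kernel; multiplying by the bounded `deriv w` keeps it integrable, which justifies
    -- Fubini.
    have := (hk2.comp_sub_left x).convolution_integrand (ContinuousLinearMap.mul ℝ ℝ) hk1.comp_neg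
    simp only [ContinuousLinearMap.mul_apply', neg_sub] at this
    exact this.mul_bdd (c := C) (hwc.comp continuous_fst).aestronglyMeasurable
      (Eventually.of_forall fun p => hC p.1)
  calc _ = ∫ s, ∫ r, kernel a b (1 - α) (x - s) * kernel a b α (s - r) * deriv w r := by
        congr 1
        funext s
        rw [convolution_def, ← integral_const_mul]
        congr 1
        funext r
        simp only [ContinuousLinearMap.mul_apply']
        ring
    _ = ∫ r, ∫ s, kernel a b (1 - α) (x - s) * kernel a b α (s - r) * deriv w r :=
        (integral_integral_swap hi).symm
    _ = ∫ r, (Iio x).indicator (fun r => betaConst α * deriv w r) r := by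
        congr 1
        funext r
        rw [integral_mul_const]
        by_cases hr : r ∈ Ioo a b
        · rw [integral_kernel_kernel hr hx]
          by_cases hrx : r < x
          · simp [hrx]
          · simp [hrx]
        · by_cases hrx : r < x <;> simp [hrx, hwz r hr]
    _ = betaConst α * w x := by
        rw [integral_indicator measurableSet_Iio, integral_const_mul,
          ← integral_Iic_eq_integral_Iio, hw.compact.integral_Iic_deriv_eq
            (hw.smooth.of_le (by simp))]

/-- The square is `r^(2α-2)`, integrable at `0` because `2α-2 > -1`. This is where `α > 1/2`, and
not merely `α > 0`, matters. -/
theorem kernel_memLp_two {a b α : ℝ} (hab : a < b) (hα : 1 / 2 < α) :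
    MemLp (kernel a b (1 - α)) 2 := by
  have h : IntervalIntegrable (fun r : ℝ => r ^ (2 * α - 2)) volume 0 (b - a) :=
    intervalIntegral.intervalIntegrable_rpow' (by linarith)
  rw [intervalIntegrable_iff_integrableOn_Ioo_of_le (by linarith)] at h
  have hm : AEStronglyMeasurable (kernel a b (1 - α)) volume :=
    (Measurable.indicator (by fun_prop) measurableSet_Ioo).aestronglyMeasurable
  rw [memLp_two_iff_integrable_sq hm]
  refine (h.integrable_indicator measurableSet_Ioo).congr (Eventually.of_forall fun r => ?_)
  by_cases hr : r ∈ Ioo 0 (b - a)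
  · simp only [kernel, indicator_of_mem hr]
    rw [← Real.rpow_natCast (r ^ _) 2, ← Real.rpow_mul hr.1.le]
    congr 1
    push_cast
    ring
  · simp [kernel, indicator_of_notMem hr]

theorem integral_mul_norm_le {X : Type*} [MeasurableSpace X] {μ : Measure X} (f g : Lp ℝ 2 μ) :
    |∫ x, f x * g x ∂μ| ≤ ‖f‖ * ‖g‖ := by
  have := abs_real_inner_le_norm g f
  rw [L2.inner_def] at this
  simpa [mul_comm] using this

/-- Sup-norm Poincaré inequality for test functions. -/
theorem exists_abs_le_mul_norm {a b α σ : ℝ} (hab : a < b) (hα : α ∈ Ioo (1 / 2 : ℝ) 1) :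
    ∃ P : ℝ, 0 ≤ P ∧ ∀ φ : ℝ → ℝ, IsTest a b φ → ∀ v : L2 a b,
      (v =ᵐ[volume.restrict (Ioo a b)] caputo a α σ φ) →
        ∀ x ∈ Ioo a b, |φ x| ≤ P * ‖v‖ := by
  have hG : 0 < Real.Gamma (1 - α) := Real.Gamma_pos_of_pos (by linarith [hα.2])
  have hB := betaConst_pos (by linarith [hα.1]) hα.2
  have hk := kernel_memLp_two hab hα.1
  obtain ⟨M, hM⟩ := isCompact_Icc.exists_bound_of_continuousOn
    (f := fun s : ℝ => Real.exp (σ * s)) (s := Icc a b) (by fun_prop)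
  obtain ⟨M', hM'⟩ := isCompact_Icc.exists_bound_of_continuousOn
    (f := fun s : ℝ => Real.exp (-σ * s)) (s := Icc a b) (by fun_prop)
  have hM0 : 0 ≤ M := (norm_nonneg _).trans (hM a (left_mem_Icc.2 hab.le))
  have hM0' : 0 ≤ M' := (norm_nonneg _).trans (hM' a (left_mem_Icc.2 hab.le))
  set N := (eLpNorm (kernel a b (1 - α)) 2 volume).toReal with hN
  have hN0 : 0 ≤ N := ENNReal.toReal_nonneg
  -- `M` and `M'` bound `e^{σs}` and `e^{-σs}` on `[a,b]`, and `M * N` bounds the `L²` norm of the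
  -- weighted kernel `f` below.
  refine ⟨M' * (Real.Gamma (1 - α) * (M * N)) / betaConst α, by positivity, ?_⟩
  intro φ hφ v hv x hx
  have hwt := hφ.weighted (σ := σ)
  set K := convolution (deriv (weighted σ φ)) (kernel a b α) (ContinuousLinearMap.mul ℝ ℝ)
    volume with hK
  have h1 := integral_kernel_convolution hab (by linarith [hα.1]) hα.2 hwt hx
  have hk' : MemLp (fun s => kernel a b (1 - α) (x - s)) 2 volume :=
    hk.comp_measurePreserving (Measure.measurePreserving_sub_left volume x)
  have hkn : eLpNorm (fun s => kernel a b (1 - α) (x - s)) 2 volume =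
      eLpNorm (kernel a b (1 - α)) 2 volume :=
    eLpNorm_comp_measurePreserving hk.aestronglyMeasurable
      (Measure.measurePreserving_sub_left volume x)
  -- By `caputo_eq`, `K s` is `Γ(1-α) e^{σs}` times the derivative of `φ`; the weight `e^{σs}` is
  -- moved onto the kernel.
  set f : ℝ → ℝ := fun s => Real.exp (σ * s) * kernel a b (1 - α) (x - s) with hf
  have hfm : AEStronglyMeasurable f (volume.restrict (Ioo a b)) :=
    ((by fun_prop : Continuous fun s : ℝ => Real.exp (σ * s)).aestronglyMeasurable).mul
      hk'.aestronglyMeasurable.restrict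
  have hle : ∀ᵐ s ∂(volume.restrict (Ioo a b)), ‖f s‖ ≤
      M * ‖kernel a b (1 - α) (x - s)‖ := by
    filter_upwards [ae_restrict_mem measurableSet_Ioo] with s hs
    rw [hf, norm_mul]
    exact mul_le_mul_of_nonneg_right (hM s (Ioo_subset_Icc_self hs)) (norm_nonneg _)
  have hfL : MemLp f 2 (volume.restrict (Ioo a b)) := (hk'.restrict _).of_le_mul hfm hle
  have hfN : ‖hfL.toLp f‖ ≤ M * N := by
    rw [Lp.norm_toLp]
    have e : eLpNorm f 2 (volume.restrict (Ioo a b)) ≤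
        ENNReal.ofReal M * eLpNorm (kernel a b (1 - α)) 2 volume := by
      refine (eLpNorm_le_mul_eLpNorm_of_ae_le_mul hle 2).trans ?_
      rw [← hkn]
      gcongr
      exact Measure.restrict_le_self
    refine (ENNReal.toReal_mono (ENNReal.mul_ne_top ENNReal.ofReal_ne_top hk.2.ne) e).trans ?_
    rw [ENNReal.toReal_mul, ENNReal.toReal_ofReal hM0]
  -- For `s ≤ a` the convolution `K` vanishes, as `deriv (weighted σ φ)` lives in `(a,b)` and the
  -- kernel is causal; for `s ≥ x` the outer kernel vanishes.
  have hz : ∀ s, s ∉ Ioo a b → kernel a b (1 - α) (x - s) * K s = 0 := by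
    intro s hs
    by_cases hsx : s < x
    · have hsa : s ≤ a := by
        by_contra h
        exact hs ⟨lt_of_not_ge h, hsx.trans hx.2⟩
      have : K s = 0 := by
        rw [hK, convolution_def, ← integral_zero ℝ ℝ]
        congr 1
        funext r
        simp only [ContinuousLinearMap.mul_apply']
        by_cases hr : r ∈ Ioo a b
        · have h2 : s - r ∉ Ioo 0 (b - a) := fun h2 => by linarith [h2.1, hr.1]
          rw [kernel, indicator_of_notMem h2, mul_zero]
        · rw [image_eq_zero_of_notMem_tsupport fun h2 =>
            hr (hwt.subset (tsupport_deriv_subset h2)), zero_mul]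
      rw [this, mul_zero]
    · have h2 : x - s ∉ Ioo 0 (b - a) := fun h2 => hsx (by linarith [h2.1])
      rw [kernel, indicator_of_notMem h2, zero_mul]
  have h2 : betaConst α * weighted σ φ x =
      Real.Gamma (1 - α) * ∫ s in Ioo a b, hfL.toLp f s * v s := by
    rw [← h1, ← setIntegral_eq_integral_of_forall_compl_eq_zero hz, ← integral_const_mul]
    refine integral_congr_ae ?_
    filter_upwards [hfL.coeFn_toLp, hv, ae_restrict_mem measurableSet_Ioo] with s hs1 hs2 hs3
    rw [hs1, hs2, caputo_eq hφ hs3, hf, neg_mul, Real.exp_neg]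
    have := (Real.exp_pos (σ * s)).ne'
    field_simp
    rfl
  have h3 : φ x = Real.exp (-σ * x) * (betaConst α * weighted σ φ x) / betaConst α := by
    rw [weighted, neg_mul, Real.exp_neg]
    have := (Real.exp_pos (σ * x)).ne'
    field_simp
  rw [h3, h2, abs_div, abs_of_pos hB, div_mul_eq_mul_div]
  gcongr
  rw [abs_mul, abs_mul, abs_of_pos hG, mul_assoc M', mul_assoc (Real.Gamma _)]
  gcongr
  · exact hM' x (Ioo_subset_Icc_self hx)
  · exact (integral_mul_norm_le _ _).trans (by gcongr)

/-- Extracting twice gives one subsequence along which both components converge a.e. -/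
theorem exists_ae_tendsto {X : Type*} [MeasurableSpace X] {μ : Measure X}
    {p : ℕ → Lp ℝ 2 μ × Lp ℝ 2 μ} {q : Lp ℝ 2 μ × Lp ℝ 2 μ} (h : Tendsto p atTop (𝓝 q)) :
    ∃ n : ℕ → ℕ, StrictMono n ∧
      (∀ᵐ x ∂μ, Tendsto (fun i => (p (n i)).1 x) atTop (𝓝 (q.1 x))) ∧
      ∀ᵐ x ∂μ, Tendsto (fun i => (p (n i)).2 x) atTop (𝓝 (q.2 x)) := by
  obtain ⟨n, hn, h1⟩ := (tendstoInMeasure_of_tendsto_Lp h.fst_nhds).exists_seq_tendsto_ae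
  obtain ⟨m, hm, h2⟩ := (tendstoInMeasure_of_tendsto_Lp
    (h.snd_nhds.comp hn.tendsto_atTop)).exists_seq_tendsto_ae
  exact ⟨n ∘ m, hn.comp hm, h1.mono fun x hx => hx.comp hm.tendsto_atTop, h2⟩

/-- Sup-norm Poincaré inequality on the completion. -/
theorem exists_ae_abs_le_mul_norm {a b α σ : ℝ} (hab : a < b) (hα : α ∈ Ioo (1 / 2 : ℝ) 1) :
    ∃ P : ℝ, 0 ≤ P ∧ ∀ p ∈ closure (testGraph a b α σ),
      ∀ᵐ x ∂(volume.restrict (Ioo a b)), |p.1 x| ≤ P * ‖p.2‖ := by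
  obtain ⟨P, hP0, hP⟩ := exists_abs_le_mul_norm (σ := σ) hab hα
  refine ⟨P, hP0, fun p hp => ?_⟩
  obtain ⟨q, hq, hqp⟩ := mem_closure_iff_seq_limit.1 hp
  obtain ⟨n, hn, h1, -⟩ := exists_ae_tendsto hqp
  have h2 : ∀ i, ∀ᵐ x ∂(volume.restrict (Ioo a b)), |(q i).1 x| ≤ P * ‖(q i).2‖ := by
    intro i
    obtain ⟨φ, hφ, e1, e2⟩ := hq i
    filter_upwards [e1, ae_restrict_mem measurableSet_Ioo] with x hx hxm
    rw [hx]
    exact hP φ hφ _ e2 x hxm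
  filter_upwards [h1, ae_all_iff.2 h2] with x hx1 hx2
  refine le_of_tendsto_of_tendsto' hx1.abs
    ((hqp.snd_nhds.norm.const_mul P).comp hn.tendsto_atTop) fun i => hx2 (n i)

/-! ### Linear structure of the graph -/

theorem IsTest.combo {a b s t : ℝ} {φ ψ : ℝ → ℝ} (hφ : IsTest a b φ) (hψ : IsTest a b ψ) :
    IsTest a b (s • φ + t • ψ) where
  smooth := (hφ.smooth.const_smul s).add (hψ.smooth.const_smul t)
  compact := (hφ.compact.smul_left (f := fun _ => s)).add (hψ.compact.smul_left (f := fun _ => t))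
  subset := by
    refine (tsupport_add _ _).trans (union_subset ?_ ?_)
    · exact (closure_mono (Function.support_const_smul_subset s φ)).trans hφ.subset
    · exact (closure_mono (Function.support_const_smul_subset t ψ)).trans hψ.subset

theorem caputo_combo {a b α σ s t : ℝ} (hab : a < b) (hα : α < 1) {φ ψ : ℝ → ℝ}
    (hφ : IsTest a b φ) (hψ : IsTest a b ψ) {x : ℝ} (hx : x ∈ Ioo a b) :
    caputo a α σ (s • φ + t • ψ) x = s * caputo a α σ φ x + t * caputo a α σ ψ x := by
  have hk := (kernel_integrable hab hα).locallyIntegrable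
  have hc : ∀ {χ : ℝ → ℝ}, IsTest a b χ → ConvolutionExistsAt (deriv (weighted σ χ))
      (kernel a b α) x (ContinuousLinearMap.mul ℝ ℝ) volume := fun h =>
    h.weighted.compact.deriv.convolutionExists_left _
      (h.weighted.smooth.continuous_deriv (by simp)) hk x
  have hd : ∀ {χ : ℝ → ℝ}, IsTest a b χ → Differentiable ℝ (weighted σ χ) := fun h =>
    h.weighted.smooth.differentiable (by simp)
  have e : deriv (weighted σ (s • φ + t • ψ)) =
      s • deriv (weighted σ φ) + t • deriv (weighted σ ψ) := by
    have : weighted σ (s • φ + t • ψ) = s • weighted σ φ + t • weighted σ ψ := by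
      funext r
      simp [weighted]
      ring
    rw [this]
    funext r
    rw [deriv_add ((hd hφ r).const_smul s) ((hd hψ r).const_smul t)]
    simp [deriv_const_smul_field]
  rw [caputo_eq (hφ.combo hψ) hx, caputo_eq hφ hx, caputo_eq hψ hx, e]
  have h1 : ∀ (c : ℝ) {f : ℝ → ℝ}, ConvolutionExistsAt f (kernel a b α) x
      (ContinuousLinearMap.mul ℝ ℝ) volume → ConvolutionExistsAt (c • f) (kernel a b α) x
      (ContinuousLinearMap.mul ℝ ℝ) volume := by
    intro c f hf
    have := Integrable.const_mul hf c
    unfold ConvolutionExistsAt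
    simpa [mul_assoc] using this
  rw [ConvolutionExistsAt.add_distrib (h1 s (hc hφ)) (h1 t (hc hψ)), smul_convolution,
    smul_convolution]
  simp only [Pi.smul_apply, smul_eq_mul]
  ring

theorem coeFn_combo {X : Type*} [MeasurableSpace X] {μ : Measure X} (s t : ℝ) (f g : Lp ℝ 2 μ) :
    (s • f + t • g : Lp ℝ 2 μ) =ᵐ[μ] fun x => s * f x + t * g x := by
  filter_upwards [Lp.coeFn_add (s • f) (t • g), Lp.coeFn_smul s f, Lp.coeFn_smul t g]
    with x e1 e2 e3
  rw [e1, Pi.add_apply, e2, e3]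
  rfl

theorem convex_testGraph {a b α σ : ℝ} (hab : a < b) (hα : α < 1) :
    Convex ℝ (testGraph a b α σ) := by
  rintro p ⟨φ, hφ, h1, h2⟩ q ⟨ψ, hψ, h3, h4⟩ s t - - -
  refine ⟨s • φ + t • ψ, hφ.combo hψ, ?_, ?_⟩
  · filter_upwards [h1, h3, coeFn_combo s t p.1 q.1] with x e1 e2 e3
    exact e3.trans (by simp [e1, e2])
  · filter_upwards [h2, h4, coeFn_combo s t p.2 q.2, ae_restrict_mem measurableSet_Ioo]
      with x e1 e2 e3 hx
    exact e3.trans (by simp [e1, e2, caputo_combo hab hα hφ hψ hx])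

theorem zero_mem_testGraph {a b α σ : ℝ} : (0 : L2 a b × L2 a b) ∈ testGraph a b α σ := by
  refine ⟨0, ⟨contDiff_const, HasCompactSupport.zero, by simp⟩, Lp.coeFn_zero _ _ _, ?_⟩
  refine (Lp.coeFn_zero _ _ _).trans (Eventually.of_forall fun x => ?_)
  simp [caputo]

/-! ### The direct method in a Hilbert space -/

section Hilbert

variable {H : Type*} [NormedAddCommGroup H] [InnerProductSpace ℝ H] [CompleteSpace H]

/-- This replaces weak compactness. The points of least norm in the sets `K n` have increasing
bounded norms, and the parallelogram law turns this into a Cauchy property; the limit lies in every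
`K n`. -/
theorem nonempty_iInter_of_antitone {K : ℕ → Set H} (hK : Antitone K) (hne : ∀ n, (K n).Nonempty)
    (hcl : ∀ n, IsClosed (K n)) (hconv : ∀ n, Convex ℝ (K n))
    (hb : Bornology.IsBounded (K 0)) : (⋂ n, K n).Nonempty := by
  choose x hx hmin using fun n =>
    exists_norm_eq_iInf_of_complete_convex (hne n) (hcl n).isComplete (hconv n) 0
  have hle : ∀ n, ∀ w ∈ K n, ‖x n‖ ≤ ‖w‖ := by
    intro n w hw
    have h := ciInf_le (f := fun w : K n => ‖(0 : H) - w‖)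
      ⟨0, Set.forall_mem_range.2 fun _ => norm_nonneg _⟩ ⟨w, hw⟩
    rw [← hmin n] at h
    simpa using h
  have hsq : ∀ n m, n ≤ m → ‖x m - x n‖ ^ 2 ≤ 2 * (‖x m‖ ^ 2 - ‖x n‖ ^ 2) := by
    intro n m hnm
    -- The midpoint of `x n` and `x m` lies in `K n` by convexity and nesting, so its norm is at
    -- least `‖x n‖`.
    have h1 := hle n _ (hconv n (hx n) (hK hnm (hx m)) (by norm_num : (0 : ℝ) ≤ 1 / 2)
      (by norm_num : (0 : ℝ) ≤ 1 / 2) (by norm_num))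
    rw [← smul_add, norm_smul] at h1
    norm_num at h1
    have h2 := parallelogram_law_with_norm ℝ (x n) (x m)
    rw [norm_sub_rev (x n)] at h2
    have h3 := norm_nonneg (x n)
    nlinarith
  obtain ⟨R, hR⟩ := hb.exists_norm_le
  have hmono : Monotone fun n => ‖x n‖ ^ 2 := fun n m hnm =>
    pow_le_pow_left₀ (norm_nonneg _) (hle n _ (hK hnm (hx m))) 2
  have hbdd : BddAbove (range fun n => ‖x n‖ ^ 2) := by
    refine ⟨R ^ 2, ?_⟩
    rintro _ ⟨n, rfl⟩
    exact pow_le_pow_left₀ (norm_nonneg _) (hR _ (hK (Nat.zero_le n) (hx n))) 2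
  have hcau : CauchySeq x := by
    have hc := (tendsto_atTop_ciSup hmono hbdd).cauchySeq
    rw [Metric.cauchySeq_iff'] at hc ⊢
    intro ε hε
    obtain ⟨N, hN⟩ := hc (ε ^ 2 / 2) (by positivity)
    refine ⟨N, fun n hn => ?_⟩
    have h1 := (le_abs_self _).trans_lt (hN n hn)
    rw [dist_eq_norm]
    refine lt_of_pow_lt_pow_left₀ 2 hε.le ?_
    linarith [hsq N n hn]
  obtain ⟨z, hz⟩ := cauchySeq_tendsto_of_complete hcau
  exact ⟨z, mem_iInter.2 fun n => (hcl n).mem_of_tendsto hz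
    (eventually_atTop.2 ⟨n, fun m hm => hK hm (hx m)⟩)⟩

/-- The direct method for convex, lower semicontinuous, coercive functions. -/
theorem exists_isMinOn_of_coercive {G : Set H} {J : H → ℝ} (hne : G.Nonempty)
    (hJ : ConvexOn ℝ G J) (hcl : ∀ c, IsClosed {p ∈ G | J p ≤ c}) {A B : ℝ} (hA : 0 < A)
    (hco : ∀ p ∈ G, ‖p‖ ^ 2 ≤ A * J p + B) : ∃ p ∈ G, ∀ q ∈ G, J p ≤ J q := by
  have hbdd : BddBelow (J '' G) := by
    -- Coercivity gives `0 ≤ A * J p + B`.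
    refine ⟨-B / A, ?_⟩
    rintro _ ⟨p, hp, rfl⟩
    rw [div_le_iff₀ hA]
    nlinarith [hco p hp, sq_nonneg ‖p‖]
  set m := sInf (J '' G) with hm
  have hpos : ∀ n : ℕ, (0 : ℝ) < 1 / (n + 1) := fun n => by positivity
  obtain ⟨p, hp⟩ := nonempty_iInter_of_antitone (K := fun n : ℕ => {p ∈ G | J p ≤ m + 1 / (n + 1)})
    (fun i j hij p hp => ⟨hp.1, hp.2.trans
      (add_le_add le_rfl (Nat.one_div_le_one_div hij))⟩)
    (fun n => by
      obtain ⟨_, ⟨p, hp, rfl⟩, h⟩ := exists_lt_of_csInf_lt (hne.image J)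
        (show m < m + 1 / (n + 1) by linarith [hpos n])
      exact ⟨p, hp, h.le⟩)
    (fun n => hcl _) (fun n => hJ.convex_le _) (by
      -- On the first sublevel set `‖p‖² ≤ T` with `T = A * (m + 1) + B`, and this forces `‖p‖ ≤ |T|
      -- + 1`.
      refine (Metric.isBounded_closedBall (x := (0 : H)) (r := |A * (m + 1) + B| + 1)).subset ?_
      rintro p ⟨hp, h⟩
      simp only [Nat.cast_zero, zero_add, div_one] at h
      rw [mem_closedBall_zero_iff]
      have h1 := hco p hp
      have h2 : A * J p ≤ A * (m + 1) := mul_le_mul_of_nonneg_left h hA.le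
      have h3 := le_abs_self (A * (m + 1) + B)
      nlinarith [abs_nonneg (A * (m + 1) + B), norm_nonneg p])
  rw [mem_iInter] at hp
  refine ⟨p, (hp 0).1, fun q hq => ?_⟩
  have h1 : J p ≤ m := by
    refine le_of_forall_pos_le_add fun ε hε => ?_
    obtain ⟨n, hn⟩ := exists_nat_one_div_lt hε
    exact (hp n).2.trans (by linarith)
  exact h1.trans (csInf_le hbdd ⟨q, hq, rfl⟩)

end Hilbert

/-! ### Integral functionals on pairs of `L²` functions -/

section Integrand

variable {X : Type*} [MeasurableSpace X] {μ : Measure X} {f : ℝ → ℝ → X → ℝ}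

/-- The integral functional with integrand `f` on `L² × L²`. -/
noncomputable def integralFunctional (μ : Measure X) (f : ℝ → ℝ → X → ℝ)
    (p : Lp ℝ 2 μ × Lp ℝ 2 μ) : ℝ :=
  ∫ t, f (p.1 t) (p.2 t) t ∂μ

theorem aestronglyMeasurable_integrand [TopologicalSpace X] [OpensMeasurableSpace X]
    [SecondCountableTopology X]
    (hf : Continuous fun p : ℝ × ℝ × X => f p.1 p.2.1 p.2.2)
    (u v : Lp ℝ 2 μ) : AEStronglyMeasurable (fun t => f (u t) (v t) t) μ :=
  (hf.measurable.comp_aemeasurable ((Lp.aestronglyMeasurable u).aemeasurable.prodMk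
    ((Lp.aestronglyMeasurable v).aemeasurable.prodMk aemeasurable_id))).aestronglyMeasurable

theorem integrable_sq (u : Lp ℝ 2 μ) : Integrable (fun t => u t ^ 2) μ :=
  (Lp.memLp u).integrable_sq

theorem integral_sq (u : Lp ℝ 2 μ) : ∫ t, u t ^ 2 ∂μ = ‖u‖ ^ 2 := by
  rw [← real_inner_self_eq_norm_sq, L2.inner_def]
  simp [sq]

/-- Quadratic growth in `y` is required only for `|x| ≤ R`, which suffices because the first
component is essentially bounded. -/
theorem integrable_integrand [IsFiniteMeasure μ] [TopologicalSpace X] [OpensMeasurableSpace X]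
    [SecondCountableTopology X]
    (hf : Continuous fun p : ℝ × ℝ × X => f p.1 p.2.1 p.2.2) {R C : ℝ}
    (hC : ∀ x y t, |x| ≤ R → |f x y t| ≤ C * (1 + y ^ 2)) {u v : Lp ℝ 2 μ}
    (hu : ∀ᵐ t ∂μ, |u t| ≤ R) : Integrable (fun t => f (u t) (v t) t) μ := by
  refine Integrable.mono' (((integrable_const 1).add (integrable_sq v)).const_mul C)
    (aestronglyMeasurable_integrand hf u v) ?_
  filter_upwards [hu] with t ht
  exact hC _ _ _ ht

theorem le_integralFunctional [IsFiniteMeasure μ] {ζ ε K : ℝ}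
    (hlow : ∀ x y t, ζ * y ^ 2 - ε * x ^ 2 - K ≤ f x y t) {p : Lp ℝ 2 μ × Lp ℝ 2 μ}
    (hp : Integrable (fun t => f (p.1 t) (p.2 t) t) μ) :
    ζ * ‖p.2‖ ^ 2 - ε * ‖p.1‖ ^ 2 - K * μ.real univ ≤ integralFunctional μ f p := by
  have h1 := (integrable_sq p.1).const_mul ε
  have h2 := (integrable_sq p.2).const_mul ζ
  have h3 : Integrable (fun _ : X => K) μ := integrable_const K
  have := integral_mono ((h2.sub h1).sub h3) hp fun t => hlow (p.1 t) (p.2 t) t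
  rw [integral_sub' (h2.sub h1) h3, integral_sub' h2 h1, integral_const_mul, integral_const_mul,
    integral_sq, integral_sq, integral_const, smul_eq_mul, mul_comm _ K] at this
  exact this

/-- Adding `ε x² + K` makes the integrand nonnegative, so Fatou applies along an a.e. convergent
subsequence. The added terms converge under strong convergence and can be subtracted again. Strong
closedness is enough, since convexity enters through the intersection argument. -/
theorem integralFunctional_le_of_tendsto [IsFiniteMeasure μ] [TopologicalSpace X]
    (hf : Continuous fun p : ℝ × ℝ × X => f p.1 p.2.1 p.2.2) {ζ ε K : ℝ} (hζ : 0 ≤ ζ)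
    (hlow : ∀ x y t, ζ * y ^ 2 - ε * x ^ 2 - K ≤ f x y t)
    {p : ℕ → Lp ℝ 2 μ × Lp ℝ 2 μ} {q : Lp ℝ 2 μ × Lp ℝ 2 μ} (hpq : Tendsto p atTop (𝓝 q))
    (hp : ∀ n, Integrable (fun t => f ((p n).1 t) ((p n).2 t) t) μ)
    (hq : Integrable (fun t => f (q.1 t) (q.2 t) t) μ) {c : ℝ}
    (hc : ∀ n, integralFunctional μ f (p n) ≤ c) : integralFunctional μ f q ≤ c := by
  obtain ⟨n, hn, h1, h2⟩ := exists_ae_tendsto hpq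
  set g : ℝ → ℝ → X → ℝ := fun x y t => f x y t + ε * x ^ 2 + K with hg
  have hg0 : ∀ x y t, 0 ≤ g x y t := fun x y t => by
    have := hlow x y t
    have : 0 ≤ ζ * y ^ 2 := by positivity
    simp only [hg]
    linarith
  have hgi : ∀ r : Lp ℝ 2 μ × Lp ℝ 2 μ, Integrable (fun t => f (r.1 t) (r.2 t) t) μ →
      Integrable (fun t => g (r.1 t) (r.2 t) t) μ := fun r hr =>
    (hr.add ((integrable_sq r.1).const_mul ε)).add (integrable_const K)
  have hge : ∀ r : Lp ℝ 2 μ × Lp ℝ 2 μ, Integrable (fun t => f (r.1 t) (r.2 t) t) μ →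
      ∫ t, g (r.1 t) (r.2 t) t ∂μ =
        integralFunctional μ f r + ε * ‖r.1‖ ^ 2 + K * μ.real univ := fun r hr => by
    have h1 := (integrable_sq r.1).const_mul ε
    have h2 : Integrable (fun t => f (r.1 t) (r.2 t) t + ε * r.1 t ^ 2) μ := hr.add h1
    simp only [hg]
    rw [integral_add h2 (integrable_const K), integral_add hr h1, integral_const_mul,
      integral_sq, integral_const, smul_eq_mul, mul_comm _ K, integralFunctional]
  have hlim : Tendsto (fun i => c + ε * ‖(p (n i)).1‖ ^ 2 + K * μ.real univ) atTop
      (𝓝 (c + ε * ‖q.1‖ ^ 2 + K * μ.real univ)) :=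
    ((((hpq.fst_nhds.comp hn.tendsto_atTop).norm.pow 2).const_mul ε).const_add c).add_const _
  have hle : ∀ i, ∫ t, g ((p (n i)).1 t) ((p (n i)).2 t) t ∂μ ≤
      c + ε * ‖(p (n i)).1‖ ^ 2 + K * μ.real univ := fun i => by
    rw [hge _ (hp _)]
    linarith [hc (n i)]
  have hfatou : ENNReal.ofReal (∫ t, g (q.1 t) (q.2 t) t ∂μ) ≤
      ENNReal.ofReal (c + ε * ‖q.1‖ ^ 2 + K * μ.real univ) := by
    rw [ofReal_integral_eq_lintegral_ofReal (hgi q hq) (Eventually.of_forall fun t => hg0 _ _ _)]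
    calc _ = ∫⁻ t, liminf (fun i => ENNReal.ofReal (g ((p (n i)).1 t) ((p (n i)).2 t) t))
          atTop ∂μ := by
          refine lintegral_congr_ae ?_
          filter_upwards [h1, h2] with t ht1 ht2
          refine (Tendsto.liminf_eq (ENNReal.tendsto_ofReal ?_)).symm
          have hft := (hf.tendsto (q.1 t, q.2 t, t)).comp
            (ht1.prodMk_nhds (ht2.prodMk_nhds tendsto_const_nhds))
          exact (hft.add ((ht1.pow 2).const_mul ε)).add_const K
      _ ≤ liminf (fun i => ∫⁻ t, ENNReal.ofReal (g ((p (n i)).1 t) ((p (n i)).2 t) t) ∂μ) atTop :=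
          lintegral_liminf_le' fun i => (hgi _ (hp _)).aestronglyMeasurable.aemeasurable.ennreal_ofReal
      _ ≤ liminf (fun i => ENNReal.ofReal (c + ε * ‖(p (n i)).1‖ ^ 2 + K * μ.real univ)) atTop := by
          refine liminf_le_liminf (Eventually.of_forall fun i => ?_)
          rw [← ofReal_integral_eq_lintegral_ofReal (hgi _ (hp _))
            (Eventually.of_forall fun t => hg0 _ _ _)]
          exact ENNReal.ofReal_le_ofReal (hle i)
      _ = _ := (ENNReal.tendsto_ofReal hlim).liminf_eq
  have hc0 : 0 ≤ c + ε * ‖q.1‖ ^ 2 + K * μ.real univ :=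
    ge_of_tendsto' hlim fun i => (integral_nonneg fun t => hg0 _ _ _).trans (hle i)
  rw [ENNReal.ofReal_le_ofReal_iff hc0, hge q hq] at hfatou
  linarith

theorem convexOn_integralFunctional (hf : ∀ t, ConvexOn ℝ univ fun z : ℝ × ℝ => f z.1 z.2 t)
    {G : Set (Lp ℝ 2 μ × Lp ℝ 2 μ)} (hG : Convex ℝ G)
    (hi : ∀ p ∈ G, Integrable (fun t => f (p.1 t) (p.2 t) t) μ) :
    ConvexOn ℝ G (integralFunctional μ f) := by
  refine ⟨hG, fun p hp q hq s t hs ht hst => ?_⟩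
  simp only [integralFunctional, smul_eq_mul]
  rw [← integral_const_mul, ← integral_const_mul,
    ← integral_add ((hi p hp).const_mul s) ((hi q hq).const_mul t)]
  refine integral_mono_ae (hi _ (hG hp hq hs ht hst))
    (((hi p hp).const_mul s).add ((hi q hq).const_mul t)) ?_
  filter_upwards [coeFn_combo s t p.1 q.1, coeFn_combo s t p.2 q.2] with τ e1 e2
  have := (hf τ).2 (mem_univ (p.1 τ, p.2 τ)) (mem_univ (q.1 τ, q.2 τ)) hs ht hst
  simp only [Prod.fst_add, Prod.snd_add, Prod.smul_fst, Prod.smul_snd, smul_eq_mul] at this ⊢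
  rw [e1, e2]
  exact this

/-- The convexity gap at the midpoint is nonnegative, and minimality of `p` and `q` makes its
integral nonpositive. So the gap vanishes a.e., and strict convexity then forces equal values a.e.
-/
theorem eq_of_isMinOn_integralFunctional
    (hf : ∀ t, StrictConvexOn ℝ univ fun z : ℝ × ℝ => f z.1 z.2 t)
    {G : Set (Lp ℝ 2 μ × Lp ℝ 2 μ)} (hG : Convex ℝ G)
    (hi : ∀ p ∈ G, Integrable (fun t => f (p.1 t) (p.2 t) t) μ)
    {p q : Lp ℝ 2 μ × Lp ℝ 2 μ} (hp : p ∈ G) (hq : q ∈ G)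
    (hpm : ∀ r ∈ G, integralFunctional μ f p ≤ integralFunctional μ f r)
    (hqm : ∀ r ∈ G, integralFunctional μ f q ≤ integralFunctional μ f r) : p = q := by
  have hh : (0 : ℝ) < 1 / 2 := by norm_num
  have hs : (1 / 2 : ℝ) + 1 / 2 = 1 := by norm_num
  set r := (1 / 2 : ℝ) • p + (1 / 2 : ℝ) • q with hr
  have hrG : r ∈ G := hG hp hq hh.le hh.le hs
  have hae : ∀ᵐ t ∂μ, r.1 t = 1 / 2 * p.1 t + 1 / 2 * q.1 t ∧
      r.2 t = 1 / 2 * p.2 t + 1 / 2 * q.2 t := by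
    filter_upwards [coeFn_combo (1 / 2) (1 / 2) p.1 q.1, coeFn_combo (1 / 2) (1 / 2) p.2 q.2]
      with τ e1 e2
    exact ⟨e1, e2⟩
  have h0 : ∀ᵐ t ∂μ, 0 ≤ 1 / 2 * f (p.1 t) (p.2 t) t + 1 / 2 * f (q.1 t) (q.2 t) t -
      f (r.1 t) (r.2 t) t := by
    filter_upwards [hae] with t ht
    have := (hf t).convexOn.2 (mem_univ (p.1 t, p.2 t)) (mem_univ (q.1 t, q.2 t)) hh.le hh.le hs
    simp only [Prod.fst_add, Prod.snd_add, Prod.smul_fst, Prod.smul_snd, smul_eq_mul] at this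
    rw [ht.1, ht.2]
    linarith
  have hpq : Integrable (fun t => 1 / 2 * f (p.1 t) (p.2 t) t + 1 / 2 * f (q.1 t) (q.2 t) t) μ :=
    ((hi p hp).const_mul (1 / 2)).add ((hi q hq).const_mul (1 / 2))
  have hint : ∫ t, (1 / 2 * f (p.1 t) (p.2 t) t + 1 / 2 * f (q.1 t) (q.2 t) t -
      f (r.1 t) (r.2 t) t) ∂μ = 0 := by
    refine le_antisymm ?_ (integral_nonneg_of_ae h0)
    rw [integral_sub hpq (hi r hrG), integral_add ((hi p hp).const_mul _) ((hi q hq).const_mul _),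
      integral_const_mul, integral_const_mul]
    have e1 := hpm r hrG
    have e2 := hqm r hrG
    simp only [integralFunctional] at e1 e2
    linarith
  rw [integral_eq_zero_iff_of_nonneg_ae h0 (hpq.sub (hi r hrG))] at hint
  have key : ∀ᵐ t ∂μ, (p.1 t, p.2 t) = (q.1 t, q.2 t) := by
    filter_upwards [hae, hint] with t ht h1
    by_contra hne
    have := (hf t).2 (mem_univ _) (mem_univ _) hne hh hh hs
    simp only [Prod.fst_add, Prod.snd_add, Prod.smul_fst, Prod.smul_snd, smul_eq_mul] at this
    simp only [Pi.zero_apply] at h1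
    rw [ht.1, ht.2] at h1
    linarith
  refine Prod.ext (Lp.ext ?_) (Lp.ext ?_)
  · filter_upwards [key] with t ht using congrArg Prod.fst ht
  · filter_upwards [key] with t ht using congrArg Prod.snd ht

end Integrand

/-! ### Pointwise growth and coercivity estimates -/

/-- Outside a large ball `|x|^(d-2) ≤ ε`, so the quadratic term dominates; inside, the power is
bounded by a constant. -/
theorem exists_abs_rpow_le {d : ℝ} (h0 : 0 < d) (hd : d < 2) {ε : ℝ} (hε : 0 < ε) :
    ∃ K : ℝ, 0 ≤ K ∧ ∀ x : ℝ, |x| ^ d ≤ ε * x ^ 2 + K := by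
  have hlim : Tendsto (fun r : ℝ => r ^ (-(2 - d))) atTop (𝓝 0) :=
    tendsto_rpow_neg_atTop (by linarith)
  obtain ⟨M, hM⟩ := eventually_atTop.1 (hlim.eventually (gt_mem_nhds hε))
  refine ⟨(max M 1) ^ d, by positivity, fun x => ?_⟩
  rcases le_total |x| (max M 1) with h | h
  · have := Real.rpow_le_rpow (abs_nonneg x) h h0.le
    nlinarith [sq_nonneg x]
  · have hx : 0 < |x| := zero_lt_one.trans_le ((le_max_right _ _).trans h)
    have h1 := (hM |x| ((le_max_left _ _).trans h)).le
    have h2 : |x| ^ d = |x| ^ (-(2 - d)) * x ^ 2 := by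
      rw [← sq_abs, ← Real.rpow_natCast, ← Real.rpow_add hx]
      congr 1
      push_cast
      ring
    rw [h2]
    have : 0 ≤ (max M 1) ^ d := by positivity
    nlinarith [mul_le_mul_of_nonneg_right h1 (sq_nonneg x)]

theorem abs_rpow_le_one_add_sq {d : ℝ} (h0 : 0 ≤ d) (hd : d ≤ 2) (y : ℝ) :
    |y| ^ d ≤ 1 + y ^ 2 := by
  rcases le_total |y| 1 with h | h
  · linarith [Real.rpow_le_one (abs_nonneg y) h h0, sq_nonneg y]
  · have := Real.rpow_le_rpow_of_exponent_le h hd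
    rw [Real.rpow_two, sq_abs] at this
    linarith

theorem growth_of_bounds {a b : ℝ} {L : ℝ → ℝ → ℝ → ℝ}
    (hL : ContinuousOn (fun p : ℝ × ℝ × ℝ => L p.1 p.2.1 p.2.2) (univ ×ˢ univ ×ˢ Icc a b))
    {d : ℝ} (hd : d ∈ Ioc (0 : ℝ) 2) {r s : ℝ → ℝ → ℝ}
    (hr : ContinuousOn (fun p : ℝ × ℝ => r p.1 p.2) (univ ×ˢ Icc a b))
    (hs : ContinuousOn (fun p : ℝ × ℝ => s p.1 p.2) (univ ×ˢ Icc a b))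
    (h : ∀ x y, ∀ t ∈ Icc a b, |L x y t - L x 0 t| ≤ r x t * |y| ^ d + s x t) (R : ℝ) :
    ∃ C, ∀ x y, ∀ t ∈ Icc a b, |x| ≤ R → |L x y t| ≤ C * (1 + y ^ 2) := by
  have hc : IsCompact (Icc (-R) R ×ˢ Icc a b) := isCompact_Icc.prod isCompact_Icc
  have hsub : Icc (-R) R ×ˢ Icc a b ⊆ univ ×ˢ Icc a b := prod_mono (subset_univ _) le_rfl
  obtain ⟨A, hA⟩ := hc.exists_bound_of_continuousOn (hr.mono hsub)
  obtain ⟨B, hB⟩ := hc.exists_bound_of_continuousOn (hs.mono hsub)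
  obtain ⟨D, hD⟩ := hc.exists_bound_of_continuousOn (f := fun p : ℝ × ℝ => L p.1 0 p.2)
    (hL.comp (f := fun p : ℝ × ℝ => (p.1, (0 : ℝ), p.2)) (by fun_prop)
      fun p hp => ⟨mem_univ _, mem_univ _, hp.2⟩)
  refine ⟨A + B + D, fun x y t ht hx => ?_⟩
  have hm : (x, t) ∈ Icc (-R) R ×ˢ Icc a b := ⟨abs_le.1 hx, ht⟩
  have h1 := hA _ hm
  have h2 := hB _ hm
  have h3 := hD _ hm
  simp only [Real.norm_eq_abs] at h1 h2 h3
  have h4 : r x t * |y| ^ d ≤ A * (1 + y ^ 2) :=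
    mul_le_mul ((le_abs_self _).trans h1) (abs_rpow_le_one_add_sq hd.1.le hd.2 y)
      (by positivity) ((abs_nonneg _).trans h1)
  have h5 := h x y t ht
  have h6 : |L x y t| ≤ |L x y t - L x 0 t| + |L x 0 t| := by
    simpa using abs_add_le (L x y t - L x 0 t) (L x 0 t)
  have h7 := (le_abs_self _).trans h2
  nlinarith [sq_nonneg y, (abs_nonneg _).trans h2, (abs_nonneg _).trans h3]

theorem exists_le_of_coercive {a b : ℝ} {L : ℝ → ℝ → ℝ → ℝ} {ζ d : ℝ} (hd : d ∈ Ico (1 : ℝ) 2)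
    {c₁ : ℝ → ℝ → ℝ} {c₂ c₃ : ℝ → ℝ} (h1 : ∀ x, ∀ t ∈ Icc a b, ζ ≤ c₁ x t)
    (h2 : ContinuousOn c₂ (Icc a b)) (h3 : ContinuousOn c₃ (Icc a b))
    (h : ∀ x y, ∀ t ∈ Icc a b, c₁ x t * |y| ^ 2 + c₂ t * |x| ^ d + c₃ t ≤ L x y t)
    {ε : ℝ} (hε : 0 < ε) :
    ∃ K, ∀ x y, ∀ t ∈ Icc a b, ζ * y ^ 2 - ε * x ^ 2 - K ≤ L x y t := by
  obtain ⟨A, hA⟩ := isCompact_Icc.exists_bound_of_continuousOn h2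
  obtain ⟨B, hB⟩ := isCompact_Icc.exists_bound_of_continuousOn h3
  -- The coefficient `c₂` may be negative, but it is at least `-(|A| + 1)`; this choice turns its
  -- term into a loss of at most `ε x²` plus a constant. The `+ 1` keeps the denominator positive.
  obtain ⟨K, hK0, hK⟩ := exists_abs_rpow_le (by linarith [hd.1]) hd.2
    (show 0 < ε / (|A| + 1) by positivity)
  refine ⟨(|A| + 1) * K + B, fun x y t ht => ?_⟩
  have e1 := mul_le_mul_of_nonneg_right (h1 x t ht) (sq_nonneg |y|)
  have e2 := (abs_le.1 ((hA t ht).trans ((le_abs_self A).trans (le_add_of_nonneg_right zero_le_one)))).1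
  have e3 := (abs_le.1 (hB t ht)).1
  have e4 : 0 ≤ |x| ^ d := by positivity
  have e5 : (|A| + 1) * |x| ^ d ≤ ε * x ^ 2 + (|A| + 1) * K := by
    refine (mul_le_mul_of_nonneg_left (hK x) (by positivity)).trans (le_of_eq ?_)
    field_simp
  have e6 := mul_le_mul_of_nonneg_right e2 e4
  have e7 := h x y t ht
  rw [sq_abs] at e1 e7
  linarith

/-! ### Existence on closed convex graphs and the main theorem -/

theorem HasCaputo.caputoH0_spec {a b α σ : ℝ} {u : L2 a b} (hu : u ∈ H0 a b α σ) :
    (u, caputoH0 a b α σ u) ∈ closure (testGraph a b α σ) := by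
  have h : ∃ v, HasCaputo a b α σ u v := hu
  rw [caputoH0, dif_pos h]
  exact h.choose_spec

theorem norm_sq_le_of_ae_abs_le {X : Type*} [MeasurableSpace X] {μ : Measure X}
    [IsFiniteMeasure μ] {u : Lp ℝ 2 μ} {R : ℝ} (h : ∀ᵐ t ∂μ, |u t| ≤ R) :
    ‖u‖ ^ 2 ≤ R ^ 2 * μ.real univ := by
  rw [← integral_sq, mul_comm, ← smul_eq_mul, ← integral_const]
  refine integral_mono_ae (integrable_sq u) (integrable_const _) ?_
  filter_upwards [h] with t ht
  exact sq_le_sq' (abs_le.1 ht).1 (abs_le.1 ht).2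

/-- Existence of a minimizer of an integral functional with a continuous convex integrand on a
closed convex set of pairs on which the first component is bounded by the second. -/
theorem exists_isMinOn_integralFunctional {X : Type*} [MeasurableSpace X] {μ : Measure X}
    [IsFiniteMeasure μ] [TopologicalSpace X] {f : ℝ → ℝ → X → ℝ}
    (hf : Continuous fun p : ℝ × ℝ × X => f p.1 p.2.1 p.2.2)
    (hconv : ∀ t, ConvexOn ℝ univ fun z : ℝ × ℝ => f z.1 z.2 t)
    {G : Set (Lp ℝ 2 μ × Lp ℝ 2 μ)} (hne : G.Nonempty) (hG : Convex ℝ G) (hGc : IsClosed G)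
    (hi : ∀ p ∈ G, Integrable (fun t => f (p.1 t) (p.2 t) t) μ) {P : ℝ} (hP0 : 0 ≤ P)
    (hP : ∀ p ∈ G, ‖p.1‖ ^ 2 ≤ P * ‖p.2‖ ^ 2) {ζ ε K : ℝ} (hζ : 0 < ζ) (hε : 0 ≤ ε)
    (hεP : ε * P ≤ ζ / 2) (hlow : ∀ x y t, ζ * y ^ 2 - ε * x ^ 2 - K ≤ f x y t) :
    ∃ p ∈ G, ∀ q ∈ G, integralFunctional μ f p ≤ integralFunctional μ f q := by
  -- The product carries the maximum norm, which is not Hilbertian; the problem is transported to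
  -- the equivalent `ℓ²` product.
  let e := WithLp.prodContinuousLinearEquiv 2 ℝ (Lp ℝ 2 μ) (Lp ℝ 2 μ)
  have hJ := convexOn_integralFunctional hconv hG hi
  have hcl : ∀ c, IsClosed {p ∈ e ⁻¹' G | integralFunctional μ f (e p) ≤ c} := fun c => by
    have : IsClosed {p ∈ G | integralFunctional μ f p ≤ c} := by
      refine IsSeqClosed.isClosed fun p q hp hpq => ?_
      have hq : q ∈ G := hGc.mem_of_tendsto hpq (Eventually.of_forall fun n => (hp n).1)
      exact ⟨hq, integralFunctional_le_of_tendsto hf hζ.le hlow hpq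
        (fun n => hi _ (hp n).1) (hi q hq) fun n => (hp n).2⟩
    exact this.preimage e.continuous
  have hco : ∀ p ∈ e ⁻¹' G, ‖p‖ ^ 2 ≤ (1 + P) * (2 / ζ) * integralFunctional μ f (e p) +
      (1 + P) * (2 / ζ) * (K * μ.real univ) := fun p hp => by
    have h1 := le_integralFunctional hlow (hi _ hp)
    have h2 := hP _ hp
    have h3 : ‖p‖ ^ 2 = ‖(e p).1‖ ^ 2 + ‖(e p).2‖ ^ 2 := WithLp.prod_norm_sq_eq_of_L2 p
    -- The loss `ε ‖(e p).1‖²` is at most `ε P ‖(e p).2‖²`, hence at most half of the coercive term.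
    have h4 : ζ / 2 * ‖(e p).2‖ ^ 2 ≤ integralFunctional μ f (e p) + K * μ.real univ := by
      nlinarith [mul_le_mul_of_nonneg_left h2 hε, sq_nonneg ‖(e p).2‖]
    have h5 : ‖(e p).2‖ ^ 2 ≤ 2 / ζ * (integralFunctional μ f (e p) + K * μ.real univ) := by
      rw [div_mul_eq_mul_div, le_div_iff₀ hζ]
      linarith
    have h6 := mul_le_mul_of_nonneg_left h5 (show 0 ≤ 1 + P by positivity)
    linarith
  obtain ⟨p, hp, hmin⟩ := exists_isMinOn_of_coercive (hne.preimage e.surjective)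
    (hJ.comp_linearMap e.toLinearEquiv.toLinearMap) hcl (by positivity) hco
  exact ⟨e p, hp, fun q hq => by simpa using hmin (e.symm q) (by simpa using hq)⟩

end TemperedFractional

theorem theorem4p1 (a b α σ : ℝ) (hab : a < b) (hα : α ∈ Ioo (1 / 2 : ℝ) 1) (hσ : 0 < σ)
    (L : ℝ → ℝ → ℝ → ℝ)
    -- `L` is of class `C¹` on `ℝ × ℝ × [a,b]`
    (hL : ContDiffOn ℝ 1 (fun p : ℝ × ℝ × ℝ => L p.1 p.2.1 p.2.2) (univ ×ˢ univ ×ˢ Icc a b))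
    -- growth of `L` in `y`
    (hL1 : ∃ d₁ ∈ Ioc (0 : ℝ) 2, ∃ r₁ s₁ : ℝ → ℝ → ℝ,
      ContinuousOn (fun p : ℝ × ℝ => r₁ p.1 p.2) (univ ×ˢ Icc a b) ∧
      ContinuousOn (fun p : ℝ × ℝ => s₁ p.1 p.2) (univ ×ˢ Icc a b) ∧
      (∀ x, ∀ t ∈ Icc a b, 0 ≤ r₁ x t ∧ 0 ≤ s₁ x t) ∧
      ∀ x y, ∀ t ∈ Icc a b, |L x y t - L x 0 t| ≤ r₁ x t * |y| ^ d₁ + s₁ x t)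
    -- growth of `∂L/∂x`
    (hL2 : ∃ d₂ ∈ Ioc (0 : ℝ) 2, ∃ r₂ s₂ : ℝ → ℝ → ℝ,
      ContinuousOn (fun p : ℝ × ℝ => r₂ p.1 p.2) (univ ×ˢ Icc a b) ∧
      ContinuousOn (fun p : ℝ × ℝ => s₂ p.1 p.2) (univ ×ˢ Icc a b) ∧
      (∀ x, ∀ t ∈ Icc a b, 0 ≤ r₂ x t ∧ 0 ≤ s₂ x t) ∧
      ∀ x y, ∀ t ∈ Icc a b, |deriv (fun z => L z y t) x| ≤ r₂ x t * |y| ^ d₂ + s₂ x t)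
    -- growth of `∂L/∂y`
    (hL3 : ∃ d₃ ∈ Ioc (0 : ℝ) 1, ∃ r₃ s₃ : ℝ → ℝ → ℝ,
      ContinuousOn (fun p : ℝ × ℝ => r₃ p.1 p.2) (univ ×ˢ Icc a b) ∧
      ContinuousOn (fun p : ℝ × ℝ => s₃ p.1 p.2) (univ ×ˢ Icc a b) ∧
      (∀ x, ∀ t ∈ Icc a b, 0 ≤ r₃ x t ∧ 0 ≤ s₃ x t) ∧
      ∀ x y, ∀ t ∈ Icc a b, |deriv (fun z => L x z t) y| ≤ r₃ x t * |y| ^ d₃ + s₃ x t)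
    -- coercivity
    (hL4 : ∃ ζ > (0 : ℝ), ∃ d₄ ∈ Ico (1 : ℝ) 2, ∃ (c₁ : ℝ → ℝ → ℝ) (c₂ c₃ : ℝ → ℝ),
      ContinuousOn (fun p : ℝ × ℝ => c₁ p.1 p.2) (univ ×ˢ Icc a b) ∧
      (∀ x, ∀ t ∈ Icc a b, ζ ≤ c₁ x t) ∧
      ContinuousOn c₂ (Icc a b) ∧ ContinuousOn c₃ (Icc a b) ∧
      ∀ x y, ∀ t ∈ Icc a b, c₁ x t * |y| ^ 2 + c₂ t * |x| ^ d₄ + c₃ t ≤ L x y t)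
    -- joint convexity in `(x,y)`
    (hL5 : ∀ t ∈ Icc a b, ConvexOn ℝ univ (fun p : ℝ × ℝ => L p.1 p.2 t)) :
    -- `J` is a well-defined real number on the whole space
    (∀ u ∈ TemperedFractional.H0 a b α σ,
      IntegrableOn (TemperedFractional.lagrangian a b α σ L u) (Ioo a b)) ∧
    -- existence of a global minimizer
    (∃ u₀ ∈ TemperedFractional.H0 a b α σ, ∀ u ∈ TemperedFractional.H0 a b α σ,
      TemperedFractional.functional a b α σ L u₀ ≤ TemperedFractional.functional a b α σ L u) ∧
    -- uniqueness under strict convexity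
    ((∀ t ∈ Icc a b, StrictConvexOn ℝ univ (fun p : ℝ × ℝ => L p.1 p.2 t)) →
      ∃! u₀, u₀ ∈ TemperedFractional.H0 a b α σ ∧ ∀ u ∈ TemperedFractional.H0 a b α σ,
        TemperedFractional.functional a b α σ L u₀ ≤
          TemperedFractional.functional a b α σ L u) := by
  obtain ⟨d₁, hd₁, r₁, s₁, hr₁, hs₁, -, hgr⟩ := hL1
  obtain ⟨ζ, hζ, d₄, hd₄, c₁, c₂, c₃, -, hc₁, hc₂, hc₃, hco⟩ := hL4
  obtain ⟨P, hP0, hP⟩ := TemperedFractional.exists_ae_abs_le_mul_norm (σ := σ) hab hα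
  set G := closure (TemperedFractional.testGraph a b α σ) with hGdef
  set μ := volume.restrict (Ioo a b) with hμ
  have hGconv : Convex ℝ G := (TemperedFractional.convex_testGraph hab hα.2).closure
  -- Projecting `t` onto `[a,b]` gives an integrand that is continuous and convex for every real `t`
  -- and agrees with `L` on `(a,b)`.
  set f : ℝ → ℝ → ℝ → ℝ := fun x y t => L x y (projIcc a b hab.le t) with hf
  have hfc : Continuous fun p : ℝ × ℝ × ℝ => f p.1 p.2.1 p.2.2 :=
    hL.continuousOn.comp_continuous
      (f := fun p : ℝ × ℝ × ℝ => (p.1, p.2.1, (projIcc a b hab.le p.2.2 : ℝ)))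
      (continuous_fst.prodMk (continuous_snd.fst.prodMk
        (continuous_subtype_val.comp (continuous_projIcc.comp continuous_snd.snd))))
      fun p => ⟨mem_univ _, mem_univ _, (projIcc a b hab.le p.2.2).2⟩
  have hi : ∀ p ∈ G, Integrable (fun t => f (p.1 t) (p.2 t) t) μ := fun p hp => by
    obtain ⟨C, hC⟩ := TemperedFractional.growth_of_bounds hL.continuousOn hd₁ hr₁ hs₁ hgr
      (P * ‖p.2‖)
    exact TemperedFractional.integrable_integrand hfc
      (fun x y t hx => hC x y _ (projIcc a b hab.le t).2 hx) (hP p hp)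
  have heq : ∀ u : TemperedFractional.L2 a b, TemperedFractional.lagrangian a b α σ L u =ᵐ[μ]
      fun t => f (u t) (TemperedFractional.caputoH0 a b α σ u t) t := fun u => by
    filter_upwards [ae_restrict_mem measurableSet_Ioo] with t ht
    simp only [hf, TemperedFractional.lagrangian,
      projIcc_of_mem hab.le (Ioo_subset_Icc_self ht)]
  have hJ : ∀ u : TemperedFractional.L2 a b, TemperedFractional.functional a b α σ L u =
      TemperedFractional.integralFunctional μ f (u, TemperedFractional.caputoH0 a b α σ u) :=
    fun u => integral_congr_ae (heq u)
  have hspec : ∀ u ∈ TemperedFractional.H0 a b α σ,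
      (u, TemperedFractional.caputoH0 a b α σ u) ∈ G := fun u hu =>
    TemperedFractional.HasCaputo.caputoH0_spec hu
  -- Uniqueness of the derivative identifies points of `G` with elements of `H0`.
  have hfst : ∀ p ∈ G, p.1 ∈ TemperedFractional.H0 a b α σ ∧
      (p.1, TemperedFractional.caputoH0 a b α σ p.1) = p := fun p hp =>
    ⟨⟨p.2, hp⟩, Prod.ext rfl (TemperedFractional.HasCaputo.caputoH0_eq hab hα.2 hp)⟩
  have hex : ∃ u₀ ∈ TemperedFractional.H0 a b α σ, ∀ u ∈ TemperedFractional.H0 a b α σ,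
      TemperedFractional.functional a b α σ L u₀ ≤ TemperedFractional.functional a b α σ L u := by
    set Q := P ^ 2 * μ.real univ with hQ
    have hQ0 : 0 ≤ Q := by positivity
    -- Chosen so that `ε * Q ≤ ζ / 2`, where `Q` is the squared `L²` Poincaré constant; the `+ 1`
    -- covers `Q = 0`.
    have hε : 0 < ζ / 2 / (Q + 1) := by positivity
    obtain ⟨K, hK⟩ := TemperedFractional.exists_le_of_coercive hd₄ hc₁ hc₂ hc₃ hco hε
    obtain ⟨p, hp, hmin⟩ := TemperedFractional.exists_isMinOn_integralFunctional (μ := μ) hfc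
      (fun t => hL5 _ (projIcc a b hab.le t).2)
      ⟨0, subset_closure TemperedFractional.zero_mem_testGraph⟩ hGconv isClosed_closure hi hQ0
      (fun p hp => (TemperedFractional.norm_sq_le_of_ae_abs_le (hP p hp)).trans
        (le_of_eq (by rw [hQ]; ring))) hζ hε.le
      (by rw [div_mul_eq_mul_div, div_le_iff₀ (by positivity)]; nlinarith)
      (fun x y t => hK x y _ (projIcc a b hab.le t).2)
    refine ⟨p.1, (hfst p hp).1, fun u hu => ?_⟩
    rw [hJ, hJ, (hfst p hp).2]
    exact hmin _ (hspec u hu)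
  refine ⟨fun u hu => (hi _ (hspec u hu)).congr (heq u).symm, hex, fun hstrict => ?_⟩
  obtain ⟨u₀, hu₀, hmin⟩ := hex
  refine ⟨u₀, ⟨hu₀, hmin⟩, fun u ⟨hu, humin⟩ => ?_⟩
  have hmin' : ∀ w : TemperedFractional.L2 a b, (∀ u ∈ TemperedFractional.H0 a b α σ,
      TemperedFractional.functional a b α σ L w ≤ TemperedFractional.functional a b α σ L u) →
      ∀ r ∈ G, TemperedFractional.integralFunctional μ f
        (w, TemperedFractional.caputoH0 a b α σ w) ≤
          TemperedFractional.integralFunctional μ f r := fun w hw r hr => by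
    have := hw r.1 (hfst r hr).1
    rwa [hJ, hJ, (hfst r hr).2] at this
  exact congrArg Prod.fst (TemperedFractional.eq_of_isMinOn_integralFunctional (μ := μ) (f := f)
    (fun t => hstrict _ (projIcc a b hab.le t).2) hGconv hi (hspec u hu) (hspec u₀ hu₀)
    (hmin' u humin) (hmin' u₀ hmin))
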